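/- Let $X\subset\mathbb R^p$ be compact and nonempty, let $G:\mathbb R^p\times\mathbb R^m\to\mathbb R$ be measurable, and let $n,t$ be positive integers. For an $n\times m$ matrix $D\in(0,1]^{n\times m}$ with rows $\xi_1,\dots,\xi_n$ (a batch of $n$ scenarios), let $$v_n(D)=\min_{x\in X}\frac1n\sum_{i=1}^n G(x,\xi_i)$$ (an infimum if no minimizer exists) be the optimal value of the sample-average approximation (SAA) problem, assumed finite for every $D\in(0,1]^{n\times m}$. *Latin hypercubes.* A Latin hypercube is an $n\times m$ array $B=(b_{ik})$ each of whose columns is a permutation of $\{1,\dots,n\}$; a random one is *ordinary* if its columns are independent and uniformly distributed permutations. An *ordinary Latin hypercube design* is the random matrix with entries $\xi_{ik}=(a_{ik}-\gamma_{ik})/n$, where $A=(a_{ik})$ is an ordinary Latin hypercube and the $\gamma_{ik}$ are uniform on $[0,1)$, mutually independent and independent of $A$. *ILH sampling.* $D_1,\dots,D_t$ are independent ordinary Latin hypercube designs. *SLH sampling.* Generate independent ordinary Latin hypercubes $A_1,\dots,A_t$ of size $n\times m$. Independently for each column $k\in\{1,\dots,m\}$ and each level $\ell\in\{1,\dots,n\}$,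 replace the $t$ occurrences of $\ell$ in the $k$th columns of $A_1,\dots,A_t$ (one in each) by a uniformly random permutation of $t(\ell-1)+1,\dots,t(\ell-1)+t$. With $(a_{r,ik})$ the resulting arrays, let $D_r$ have entries $\xi_{r,ik}=(a_{r,ik}-\gamma_{r,ik})/(nt)$, where the $\gamma_{r,ik}$ are uniform on $[0,1)$, mutually independent and independent of the $a_{r,ik}$. Let $L^{ILH}_{n,t}$ and $L^{SLH}_{n,t}$ denote the lower-bound estimator $\frac1t\sum_{r=1}^t v_n(D_r)$ when $(D_1,\dots,D_t)$ is generated by ILH sampling and by SLH sampling, respectively. *Monotonicity.* For a Latin hypercube $B$ and $\Delta=(\delta_{\ell k})\in[0,1)^{n\times m}$ put $H(\Delta;B)=v_n((B-\Theta)/n)$, where $\Theta=(\theta_{ik})$ and $\theta_{ik}=\delta_{\ell k}$ with $\ell=b_{ik}$. The function $v_n$ is *monotonic* if for each pair $(\ell,k)$ one of the following holds: for all $B$ and all fixed values of the other entries of $\Delta$, $H(\Delta;B)$ is nondecreasing in $\delta_{\ell k}\in[0,1)$; or, for all $B$ and all fixed values of the other entries of $\Delta$, $H(\Delta;B)$ is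 nonincreasing in $\delta_{\ell k}\in[0,1)$. **Theorem.** If $v_n$ is monotonic, then $$\operatorname{var}\bigl(L^{SLH}_{n,t}\bigr)\le\operatorname{var}\bigl(L^{ILH}_{n,t}\bigr).$$ Here the variance takes values in $[0,\infty]$ and is $\infty$ for a random variable without finite second moment. -/

import Mathlib

open MeasureTheory ProbabilityTheory
open scoped ENNReal

noncomputable section

namespace SAA

/-- A batch of `n` scenarios in dimension `m`: the `n × m` matrix whose `i`-th row is the `i`-th
scenario. -/
abbrev Design (n m : ℕ) : Type := Fin n → Fin m → ℝ

/-- The design space `(0,1]^{n × m}`. -/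
def designSpace (n m : ℕ) : Set (Design n m) := {D | ∀ i k, D i k ∈ Set.Ioc (0 : ℝ) 1}

/-- The sample-average approximation `(1/n) ∑ i, G(x, ξ_i)`, where `ξ_i` is the `i`-th row of `D`. -/
def saaObjective {p n m : ℕ} (G : EuclideanSpace ℝ (Fin p) → (Fin m → ℝ) → ℝ)
    (D : Design n m) (x : EuclideanSpace ℝ (Fin p)) : ℝ :=
  (1 / (n : ℝ)) * ∑ i, G x (D i)

/-- The optimal value `v_n(D)` of the SAA problem over the feasible set `X`. -/
def saaValue {p n m : ℕ} (X : Set (EuclideanSpace ℝ (Fin p)))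
    (G : EuclideanSpace ℝ (Fin p) → (Fin m → ℝ) → ℝ) (D : Design n m) : ℝ :=
  sInf (saaObjective G D '' X)

/-- The lower-bound estimator `(v(D_1) + ... + v(D_t)) / t`. -/
def lowerBound {n m t : ℕ} (v : Design n m → ℝ) (D : Fin t → Design n m) : ℝ :=
  (∑ r, v (D r)) / (t : ℝ)

/-- The columns of an `n × m` Latin hypercube. The entry in row `i` and column `k` is
`b_{ik} = B k i + 1`, since `Fin n` is `{0, ..., n - 1}`. -/
abbrev LatinHypercube (n m : ℕ) : Type := Fin m → Equiv.Perm (Fin n)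

/-- `H(Δ; B) = v((B - Θ) / n)`, where `θ_{ik} = δ_{ℓk}` for `ℓ = b_{ik}`. -/
def offsetValue {n m : ℕ} (v : Design n m → ℝ) (B : LatinHypercube n m)
    (Δ : Fin n → Fin m → ℝ) : ℝ :=
  v fun i k => ((((B k i : ℕ) : ℝ) + 1) - Δ (B k i) k) / (n : ℝ)

/-- `Δ` with its entry `(ℓ, k)` replaced by `s`. -/
def replaceEntry {n m : ℕ} (Δ : Fin n → Fin m → ℝ) (ℓ : Fin n) (k : Fin m) (s : ℝ) :
    Fin n → Fin m → ℝ :=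
  Function.update Δ ℓ (Function.update (Δ ℓ) k s)

/-- `v` is monotonic: for each stratum `ℓ` and coordinate `k`, either `H(·; B)` is nondecreasing in
`δ_{ℓk} ∈ [0,1)` for all Latin hypercubes `B` and all values in `[0,1)` of the other offsets, or
it is nonincreasing in `δ_{ℓk}` for all of them. -/
def IsMonotonic {n m : ℕ} (v : Design n m → ℝ) : Prop :=
  ∀ (ℓ : Fin n) (k : Fin m),
    (∀ (B : LatinHypercube n m) (Δ : Fin n → Fin m → ℝ), (∀ j q, Δ j q ∈ Set.Ico (0 : ℝ) 1) →
      MonotoneOn (fun s => offsetValue v B (replaceEntry Δ ℓ k s)) (Set.Ico (0 : ℝ) 1)) ∨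
    (∀ (B : LatinHypercube n m) (Δ : Fin n → Fin m → ℝ), (∀ j q, Δ j q ∈ Set.Ico (0 : ℝ) 1) →
      AntitoneOn (fun s => offsetValue v B (replaceEntry Δ ℓ k s)) (Set.Ico (0 : ℝ) 1))

instance permMeasurableSpace (n : ℕ) : MeasurableSpace (Equiv.Perm (Fin n)) := ⊤

instance permDiscrete (n : ℕ) : DiscreteMeasurableSpace (Equiv.Perm (Fin n)) := ⟨fun _ => trivial⟩

/-- The law of a uniform random permutation of `n` elements. -/
def uniformPerm (n : ℕ) : Measure (Equiv.Perm (Fin n)) := uniformOn Set.univ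

/-- The uniform distribution on `[0,1)`. -/
def uniformUnit : Measure ℝ := volume.restrict (Set.Ico (0 : ℝ) 1)

/-- The law of an ordinary Latin hypercube: independent uniformly permuted columns. -/
def latinHypercubeLaw (n m : ℕ) : Measure (LatinHypercube n m) :=
  Measure.pi fun _ => uniformPerm n

/-- The law of an `n × m` matrix with independent entries uniform on `[0,1)`. -/
def jitterLaw (n m : ℕ) : Measure (Fin n → Fin m → ℝ) :=
  Measure.pi fun _ => Measure.pi fun _ => uniformUnit

/-- `ξ_{ik} = (a_{ik} - γ_{ik}) / n`. -/
def lhDesign {n m : ℕ} (s : LatinHypercube n m × (Fin n → Fin m → ℝ)) : Design n m :=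
  fun i k => ((((s.1 k i : ℕ) : ℝ) + 1) - s.2 i k) / (n : ℝ)

/-- The law of an ordinary Latin hypercube design. -/
def lhLaw (n m : ℕ) : Measure (Design n m) :=
  ((latinHypercubeLaw n m).prod (jitterLaw n m)).map lhDesign

/-- ILH sampling: the joint law of `t` independent ordinary Latin hypercube designs. -/
def ilhLaw (n m t : ℕ) : Measure (Fin t → Design n m) :=
  Measure.pi fun _ => lhLaw n m

/-- The random inputs of sliced Latin hypercube sampling: the Latin hypercubes `A_r`, the
permutation of the `t` elements used for column `k` and level `ℓ`, and the offsets `γ_{r,ik}`. -/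
abbrev SlhInput (n m t : ℕ) : Type :=
  (Fin t → LatinHypercube n m) × (Fin m → Fin n → Equiv.Perm (Fin t)) ×
    (Fin t → Fin n → Fin m → ℝ)

/-- All random inputs are mutually independent and uniform. -/
def slhInputLaw (n m t : ℕ) : Measure (SlhInput n m t) :=
  (Measure.pi fun _ => latinHypercubeLaw n m).prod
    ((Measure.pi fun _ => Measure.pi fun _ => uniformPerm t).prod
      (Measure.pi fun _ => jitterLaw n m))

/-- The entry of the `r`-th slice after the replacement step: in column `k`, the occurrences of a
level `ℓ ∈ {1, ..., n}`, one in each of the `t` Latin hypercubes, are replaced by the randomly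
permuted numbers `t(ℓ-1)+1, ..., t(ℓ-1)+t`. In the code, the level is `s.1 r k i = ℓ - 1`. -/
def slhEntry {n m t : ℕ} (s : SlhInput n m t) (r : Fin t) (i : Fin n) (k : Fin m) : ℕ :=
  t * (s.1 r k i : ℕ) + ((s.2.1 k (s.1 r k i) r : ℕ) + 1)

/-- `ξ_{r,ik} = (a_{r,ik} - γ_{r,ik}) / (n t)`. -/
def slhDesign {n m t : ℕ} (s : SlhInput n m t) : Fin t → Design n m :=
  fun r i k => ((slhEntry s r i k : ℝ) - s.2.2 r i k) / ((n : ℝ) * (t : ℝ))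

/-- SLH sampling: the joint law of the `t` slices of a sliced Latin hypercube design. -/
def slhLaw (n m t : ℕ) : Measure (Fin t → Design n m) :=
  (slhInputLaw n m t).map slhDesign

theorem measurable_lhDesign {n m : ℕ} : Measurable (lhDesign (n := n) (m := m)) := by
  refine measurable_pi_lambda _ fun i => measurable_pi_lambda _ fun k => ?_
  have h1 : Measurable fun s : LatinHypercube n m × (Fin n → Fin m → ℝ) =>
      (((s.1 k i : ℕ) : ℝ) + 1) :=
    (Measurable.of_discrete (f := fun B : LatinHypercube n m => (((B k i : ℕ) : ℝ) + 1))).comp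
      measurable_fst
  have h2 : Measurable fun s : LatinHypercube n m × (Fin n → Fin m → ℝ) => s.2 i k := by fun_prop
  exact (h1.sub h2).div_const _

theorem measurable_slhEntry {n m t : ℕ} (r : Fin t) (i : Fin n) (k : Fin m) :
    Measurable fun s : SlhInput n m t => slhEntry s r i k := by
  have hF : Measurable fun q : Equiv.Perm (Fin n) × (Fin n → Equiv.Perm (Fin t)) =>
      t * (q.1 i : ℕ) + ((q.2 (q.1 i) r : ℕ) + 1) := Measurable.of_discrete
  have hp : Measurable fun s : SlhInput n m t => (s.1 r k, s.2.1 k) := by fun_prop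
  exact hF.comp hp

theorem measurable_slhDesign {n m t : ℕ} :
    Measurable (slhDesign (n := n) (m := m) (t := t)) := by
  refine measurable_pi_lambda _ fun r => measurable_pi_lambda _ fun i =>
    measurable_pi_lambda _ fun k => ?_
  have h1 : Measurable fun s : SlhInput n m t => (slhEntry s r i k : ℝ) :=
    (Measurable.of_discrete (f := fun a : ℕ => (a : ℝ))).comp (measurable_slhEntry r i k)
  have h2 : Measurable fun s : SlhInput n m t => s.2.2 r i k := by fun_prop
  exact (h1.sub h2).div_const _

instance uniformPerm_isProbabilityMeasure (n : ℕ) : IsProbabilityMeasure (uniformPerm n) :=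
  isProbabilityMeasure_uniformOn Set.finite_univ Set.univ_nonempty

instance uniformUnit_isProbabilityMeasure : IsProbabilityMeasure uniformUnit :=
  ⟨by simp [uniformUnit]⟩

instance latinHypercubeLaw_isProbabilityMeasure (n m : ℕ) :
    IsProbabilityMeasure (latinHypercubeLaw n m) := by
  unfold latinHypercubeLaw; infer_instance

instance jitterLaw_isProbabilityMeasure (n m : ℕ) : IsProbabilityMeasure (jitterLaw n m) := by
  unfold jitterLaw; infer_instance

instance lhLaw_isProbabilityMeasure (n m : ℕ) : IsProbabilityMeasure (lhLaw n m) :=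
  Measure.isProbabilityMeasure_map measurable_lhDesign.aemeasurable

instance ilhLaw_isProbabilityMeasure (n m t : ℕ) : IsProbabilityMeasure (ilhLaw n m t) := by
  unfold ilhLaw; infer_instance

instance slhInputLaw_isProbabilityMeasure (n m t : ℕ) :
    IsProbabilityMeasure (slhInputLaw n m t) := by
  unfold slhInputLaw; infer_instance

instance slhLaw_isProbabilityMeasure (n m t : ℕ) : IsProbabilityMeasure (slhLaw n m t) :=
  Measure.isProbabilityMeasure_map measurable_slhDesign.aemeasurable

end SAA

end

/-!
Sliced sampling differs from independent sampling only in the joint law of the batches, not in the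
law of a single one. So it suffices to show that the values `v (D_r)` and `v (D_s)` of two different
slices have nonpositive covariance: the variance of the mean of the `t` values is the sum of their
covariances divided by `t ^ 2`, and for independent batches the mixed terms vanish.

Write each slice as an ordinary design whose offset at level `ℓ` of column `k` is
`(t - 1 - π_{kℓ}(r) + γ) / t`, where `π_{kℓ}` is the permutation that refines this level
(`slhDesign_apply_eq_sliceDesign`). A stratified offset is again uniform, which identifies the
marginal law (`measurePreserving_sliceDesign`, `measurePreserving_eval_slhLaw`). Given all
permutations, the slices are independent, and the conditional mean of `v (D_r)` is `h(π_{··}(r))`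
for a function `h` on a finite set of strata (`strataMean`). Hence the covariance of two slices is
that of `h(π_{··}(r))` and `h(π_{··}(s))`. Monotonicity of `v` in the offsets makes `h` monotone or
antitone in each coordinate (`IsMonotonic.similarlyMonotone_strataMean`). For one coordinate,
negative correlation of `h(π(r))` and `h(π(s))` is Chebyshev's sum inequality
(`card_mul_sum_perm_le`); averaging over one coordinate at a time extends it to all of them
(`card_mul_sum_pi_perm_le`).

Two analytic points remain. The optimal value is an infimum over an uncountable set, and its
measurability is not assumed; it follows from monotonicity, since upper sets in `ℝ^ι` are Lebesgue
measurable (`aemeasurable_of_coordinatewise_monotone`, `IsMonotonic.aemeasurable`). And if the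
value of a batch is not square-integrable, then the estimator for independent batches has infinite
variance (`memLp_of_memLp_lowerBound`), so that there is nothing to prove.
-/

noncomputable section

namespace SAA

/-! ### Negative dependence of independent uniform permutations -/

/-- Chebyshev's sum inequality, read along a random permutation: two distinct values `π r` and
`π s` of a uniform permutation are negatively correlated after similarly ordered transformations. -/
theorem card_mul_sum_perm_le {α : Type*} [Fintype α] [DecidableEq α] {r s : α} (hrs : r ≠ s)
    {F G : α → ℝ} (hFG : Monovary F G) :
    (Fintype.card (Equiv.Perm α) : ℝ) * ∑ π : Equiv.Perm α, F (π r) * G (π s) ≤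
      (∑ π : Equiv.Perm α, F (π r)) * ∑ π : Equiv.Perm α, G (π s) := by
  set N : ℝ := (Fintype.card (Equiv.Perm α) : ℝ) with hNdef
  set T : ℝ := (Fintype.card α : ℝ) with hT
  have hT1 : (1 : ℝ) < T := by
    rw [hT]; exact_mod_cast Fintype.one_lt_card_iff.2 ⟨r, s, hrs⟩
  have hsum : ∀ (H : α → ℝ) (π : Equiv.Perm α), ∑ a, H (π a) = ∑ a, H a := fun H π =>
    Equiv.sum_comp π H
  -- The sum over permutations does not depend on the pair of distinct points.
  have hpair : ∀ a b : α, a ≠ b →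
      ∑ π : Equiv.Perm α, F (π a) * G (π b) = ∑ π : Equiv.Perm α, F (π r) * G (π s) := by
    intro a b hab
    obtain ⟨σ, hσr, hσs⟩ : ∃ σ : Equiv.Perm α, σ r = a ∧ σ s = b := by
      refine ⟨Equiv.swap (Equiv.swap r a s) b * Equiv.swap r a, ?_, ?_⟩
      · have h1 : a ≠ Equiv.swap r a s := fun h => hrs (by
          have := congrArg (Equiv.swap r a) h
          simpa using this)
        simp [Equiv.swap_apply_of_ne_of_ne h1 hab]
      · simp
    subst hσr hσs
    exact Equiv.sum_comp (Equiv.mulRight σ) fun π : Equiv.Perm α => F (π r) * G (π s)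
  have hone : ∀ (H : α → ℝ) (a b : α),
      ∑ π : Equiv.Perm α, H (π a) = ∑ π : Equiv.Perm α, H (π b) := by
    intro H a b
    rw [← Equiv.sum_comp (Equiv.mulRight (Equiv.swap a b))]
    simp
  have hmean : ∀ (H : α → ℝ) (a : α), T * ∑ π : Equiv.Perm α, H (π a) = N * ∑ b, H b := by
    intro H a
    have h1 : ∑ b : α, ∑ π : Equiv.Perm α, H (π b) = T * ∑ π : Equiv.Perm α, H (π a) := by
      rw [Finset.sum_congr rfl fun b _ => hone H b a]
      simp [T]
    rw [← h1, Finset.sum_comm]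
    simp [hsum, N]
  -- Sum over all ordered pairs of distinct points.
  have htotal : T * (T - 1) * ∑ π : Equiv.Perm α, F (π r) * G (π s) =
      N * ((∑ a, F a) * (∑ a, G a) - ∑ a, F a * G a) := by
    have h1 : ∀ a : α, ∑ b ∈ Finset.univ.erase a, ∑ π : Equiv.Perm α, F (π a) * G (π b) =
        (T - 1) * ∑ π : Equiv.Perm α, F (π r) * G (π s) := by
      intro a
      rw [Finset.sum_congr rfl fun b hb => hpair a b (Finset.ne_of_mem_erase hb).symm]
      rw [Finset.sum_const, Finset.card_erase_of_mem (Finset.mem_univ a), nsmul_eq_mul,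
        Nat.cast_sub (Finset.card_pos.2 ⟨a, Finset.mem_univ a⟩)]
      simp [T]
    have h2 : ∑ a : α, ∑ b ∈ Finset.univ.erase a, ∑ π : Equiv.Perm α, F (π a) * G (π b) =
        T * (T - 1) * ∑ π : Equiv.Perm α, F (π r) * G (π s) := by
      rw [Finset.sum_congr rfl fun a _ => h1 a]
      simp [T, mul_assoc]
    have h3 : ∀ a : α, ∑ b ∈ Finset.univ.erase a, ∑ π : Equiv.Perm α, F (π a) * G (π b) =
        ∑ π : Equiv.Perm α, (F (π a) * (∑ c, G c) - F (π a) * G (π a)) := by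
      intro a
      rw [Finset.sum_comm]
      refine Finset.sum_congr rfl fun π _ => ?_
      rw [← hsum G π, ← Finset.add_sum_erase _ _ (Finset.mem_univ a), ← Finset.mul_sum]
      ring
    rw [← h2, Finset.sum_congr rfl fun a _ => h3 a, Finset.sum_comm]
    have h4 : ∀ π : Equiv.Perm α, ∑ a, (F (π a) * (∑ c, G c) - F (π a) * G (π a)) =
        (∑ a, F a) * (∑ a, G a) - ∑ a, F a * G a := by
      intro π
      rw [Finset.sum_sub_distrib, ← Finset.sum_mul, hsum F π, hsum (fun a => F a * G a) π]
    simp [h4, N, mul_sub]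
  have hcheb : (∑ a, F a) * (∑ a, G a) ≤ T * ∑ a, F a * G a := hFG.sum_mul_sum_le_card_mul_sum
  have hF := hmean F r
  have hG := hmean G s
  have hN : 0 ≤ N := Nat.cast_nonneg _
  have key : T * (T - 1) * T * (N * ∑ π : Equiv.Perm α, F (π r) * G (π s)) ≤
      T * (T - 1) * T * ((∑ π : Equiv.Perm α, F (π r)) * ∑ π : Equiv.Perm α, G (π s)) := by
    have e1 : T * (T - 1) * T * (N * ∑ π : Equiv.Perm α, F (π r) * G (π s)) =
        N * N * (T * ((∑ a, F a) * (∑ a, G a)) - T * ∑ a, F a * G a) := by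
      linear_combination T * N * htotal
    have e2 : T * (T - 1) * T * ((∑ π : Equiv.Perm α, F (π r)) * ∑ π : Equiv.Perm α, G (π s)) =
        N * N * (T * ((∑ a, F a) * (∑ a, G a)) - (∑ a, F a) * (∑ a, G a)) := by
      linear_combination (T - 1) * (T * ∑ π : Equiv.Perm α, G (π s)) * hF +
        (T - 1) * (N * ∑ a, F a) * hG
    rw [e1, e2]
    exact mul_le_mul_of_nonneg_left (by linarith) (mul_nonneg hN hN)
  have hpos : 0 < T * (T - 1) * T := by
    have : 0 < T - 1 := by linarith
    positivity
  exact le_of_mul_le_mul_left key hpos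

/-- The functions `f` and `g` of several variables are ordered in the same direction along each
coordinate: both are monotone in it or both are antitone. -/
def SimilarlyMonotone {ι α : Type*} [Preorder α] [DecidableEq ι] (f g : (ι → α) → ℝ) : Prop :=
  ∀ i, ((∀ c, Monotone fun a => f (Function.update c i a)) ∧
      ∀ c, Monotone fun a => g (Function.update c i a)) ∨
    ((∀ c, Antitone fun a => f (Function.update c i a)) ∧
      ∀ c, Antitone fun a => g (Function.update c i a))

/-- Evaluating independent uniform permutations, one for each coordinate, at two distinct points
gives negatively correlated values of similarly monotone functions. The proof averages over one
coordinate at a time: the average inherits monotonicity in the others. -/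
theorem card_mul_sum_pi_perm_le {ι α : Type*} [Fintype ι] [DecidableEq ι] [Fintype α]
    [LinearOrder α] {r s : α} (hrs : r ≠ s) (f g : (ι → α) → ℝ) (hfg : SimilarlyMonotone f g) :
    (Fintype.card (ι → Equiv.Perm α) : ℝ) *
        ∑ π : ι → Equiv.Perm α, f (fun i => π i r) * g (fun i => π i s) ≤
      (∑ π : ι → Equiv.Perm α, f (fun i => π i r)) *
        ∑ π : ι → Equiv.Perm α, g (fun i => π i s) := by
  classical
  suffices H : ∀ (N : ℕ) (f g : (Fin N → α) → ℝ), SimilarlyMonotone f g →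
      (Fintype.card (Fin N → Equiv.Perm α) : ℝ) *
        ∑ π : Fin N → Equiv.Perm α, f (fun i => π i r) * g (fun i => π i s) ≤
      (∑ π : Fin N → Equiv.Perm α, f (fun i => π i r)) *
        ∑ π : Fin N → Equiv.Perm α, g (fun i => π i s) by
    let e := Fintype.equivFin ι
    have hupd : ∀ (c : Fin (Fintype.card ι) → α) (i : Fin (Fintype.card ι)) (a : α),
        (fun j => Function.update c i a (e j)) =
          Function.update (fun j => c (e j)) (e.symm i) a := by
      intro c i a
      funext j
      by_cases h : j = e.symm i
      · subst h; simp
      · have h' : e j ≠ i := fun h' => h (by simp [← h'])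
        simp [Function.update_of_ne h, Function.update_of_ne h']
    have h := H _ (fun c => f fun j => c (e j)) (fun c => g fun j => c (e j)) (fun i => by
      simp only [hupd]
      rcases hfg (e.symm i) with h | h
      · exact Or.inl ⟨fun c => h.1 _, fun c => h.2 _⟩
      · exact Or.inr ⟨fun c => h.1 _, fun c => h.2 _⟩)
    have hs : ∀ Φ : (ι → Equiv.Perm α) → ℝ,
        ∑ π : Fin (Fintype.card ι) → Equiv.Perm α, Φ (fun j => π (e j)) = ∑ π, Φ π := fun Φ =>
      Equiv.sum_comp (Equiv.arrowCongr e.symm (Equiv.refl (Equiv.Perm α))) Φ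
    have hc : Fintype.card (Fin (Fintype.card ι) → Equiv.Perm α) =
        Fintype.card (ι → Equiv.Perm α) :=
      Fintype.card_congr (Equiv.arrowCongr e.symm (Equiv.refl (Equiv.Perm α)))
    rw [hc, hs fun π => f (fun i => π i r) * g (fun i => π i s), hs fun π => f (fun i => π i r),
      hs fun π => g (fun i => π i s)] at h
    exact h
  clear hfg f g
  intro N
  induction N with
  | zero => intro f g _; simp
  | succ N ih =>
    intro f g hfg
    have hs : ∀ Φ : (Fin (N + 1) → Equiv.Perm α) → ℝ,
        ∑ π, Φ π = ∑ π : Fin N → Equiv.Perm α, ∑ p : Equiv.Perm α, Φ (Fin.cons p π) := by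
      intro Φ
      rw [← Equiv.sum_comp (Fin.consEquiv fun _ => Equiv.Perm α), Fintype.sum_prod_type_right]
      rfl
    have hcons : ∀ (p : Equiv.Perm α) (π : Fin N → Equiv.Perm α) (a : α),
        (fun i => (Fin.cons p π : Fin (N + 1) → Equiv.Perm α) i a) =
          (Fin.cons (p a) fun i => π i a : Fin (N + 1) → α) := by
      intro p π a
      funext i
      refine Fin.cases ?_ (fun j => ?_) i <;> simp
    have hcard : (Fintype.card (Fin (N + 1) → Equiv.Perm α) : ℝ) =
        Fintype.card (Fin N → Equiv.Perm α) * Fintype.card (Equiv.Perm α) := by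
      simp [pow_succ]
    let F : (Fin N → α) → ℝ := fun c => ∑ p : Equiv.Perm α, f (Fin.cons (p r) c)
    let G : (Fin N → α) → ℝ := fun c => ∑ p : Equiv.Perm α, g (Fin.cons (p s) c)
    have hFG : SimilarlyMonotone F G := by
      intro i
      simp only [F, G, Fin.cons_update]
      rcases hfg i.succ with h | h
      · exact Or.inl ⟨fun c a b hab => Finset.sum_le_sum fun p _ => h.1 _ hab,
          fun c a b hab => Finset.sum_le_sum fun p _ => h.2 _ hab⟩
      · exact Or.inr ⟨fun c a b hab => Finset.sum_le_sum fun p _ => h.1 _ hab,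
          fun c a b hab => Finset.sum_le_sum fun p _ => h.2 _ hab⟩
    have hstep : ∀ c d : Fin N → α, (Fintype.card (Equiv.Perm α) : ℝ) *
        ∑ p : Equiv.Perm α, f (Fin.cons (p r) c) * g (Fin.cons (p s) d) ≤ F c * G d := by
      intro c d
      have hupd : ∀ (c : Fin N → α) (a : α), (Fin.cons a c : Fin (N + 1) → α) =
          Function.update (Fin.cons r c : Fin (N + 1) → α) 0 a := fun c a => by
        rw [Fin.update_cons_zero]
      refine card_mul_sum_perm_le hrs (F := fun a => f (Fin.cons a c))
        (G := fun a => g (Fin.cons a d)) ?_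
      rcases hfg 0 with h | h
      · refine Monotone.monovary (f := fun a => f (Fin.cons a c))
          (g := fun a => g (Fin.cons a d)) ?_ ?_
        · simpa only [← hupd] using h.1 (Fin.cons r c)
        · simpa only [← hupd] using h.2 (Fin.cons r d)
      · refine Antitone.monovary (f := fun a => f (Fin.cons a c))
          (g := fun a => g (Fin.cons a d)) ?_ ?_
        · simpa only [← hupd] using h.1 (Fin.cons r c)
        · simpa only [← hupd] using h.2 (Fin.cons r d)
    rw [hs, hs, hs, hcard]
    simp only [hcons]
    refine le_trans ?_ (ih F G hFG)
    rw [mul_assoc, Finset.mul_sum]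
    exact mul_le_mul_of_nonneg_left (Finset.sum_le_sum fun π _ => hstep _ _) (Nat.cast_nonneg _)

/-! ### Measurability of coordinatewise monotone functions -/

/-- A function that is monotone or antitone in each variable on a product of sets increases
whenever each variable moves in its favourable direction. -/
theorem le_of_forall_update_le {ι β : Type*} [Finite ι] [DecidableEq ι] [Preorder β]
    {f : (ι → ℝ) → β} {S : ι → Set ℝ} {ε : ι → Prop} [DecidablePred ε]
    (hf : ∀ i, ∀ x ∈ Set.univ.pi S, if ε i then
      MonotoneOn (fun s => f (Function.update x i s)) (S i) else
      AntitoneOn (fun s => f (Function.update x i s)) (S i))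
    {x y : ι → ℝ} (hx : x ∈ Set.univ.pi S) (hy : y ∈ Set.univ.pi S)
    (hxy : ∀ i, if ε i then x i ≤ y i else y i ≤ x i) : f x ≤ f y := by
  have := Fintype.ofFinite ι
  suffices h : ∀ A : Finset ι, f x ≤ f (A.piecewise y x) by
    simpa using h Finset.univ
  intro A
  induction A using Finset.induction_on with
  | empty => simp
  | insert i A hi ih =>
    refine ih.trans ?_
    set z := A.piecewise y x with hz
    have hzS : z ∈ Set.univ.pi S := fun j _ => by
      by_cases hj : j ∈ A
      · simpa [hz, hj] using hy j trivial
      · simpa [hz, hj] using hx j trivial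
    have hzi : z i = x i := by simp [hz, hi]
    rw [Finset.piecewise_insert]
    have h := hf i z hzS
    have hi' := hxy i
    have hself : f z = f (Function.update z i (x i)) := by rw [← hzi, Function.update_eq_self]
    rw [hself]
    split_ifs at h hi' with he
    · exact h (hx i trivial) (hy i trivial) hi'
    · exact h (hy i trivial) (hx i trivial) hi'

/-- After reflecting the coordinates in which the function is antitone, its superlevel sets become
upper sets, and upper sets in `ℝ^ι` are Lebesgue measurable. -/
theorem aemeasurable_of_coordinatewise_monotone {ι : Type*} [Fintype ι] [DecidableEq ι]
    {f : (ι → ℝ) → ℝ} {S : ι → Set ℝ} (hS : ∀ i, MeasurableSet (S i))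
    (hf : ∀ i, (∀ x ∈ Set.univ.pi S, MonotoneOn (fun s => f (Function.update x i s)) (S i)) ∨
      ∀ x ∈ Set.univ.pi S, AntitoneOn (fun s => f (Function.update x i s)) (S i)) :
    AEMeasurable f (volume.restrict (Set.univ.pi S)) := by
  classical
  let ε : ι → Prop := fun i =>
    ∀ x ∈ Set.univ.pi S, MonotoneOn (fun s => f (Function.update x i s)) (S i)
  have hf' : ∀ i, ∀ x ∈ Set.univ.pi S, if ε i then
      MonotoneOn (fun s => f (Function.update x i s)) (S i) else
      AntitoneOn (fun s => f (Function.update x i s)) (S i) := by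
    intro i x hx
    split_ifs with h
    · exact h x hx
    · exact (hf i).resolve_left h x hx
  have hSm : MeasurableSet (Set.univ.pi S) := MeasurableSet.univ_pi hS
  let ρ : (ι → ℝ) → ι → ℝ := fun x i => if ε i then x i else -x i
  have hρ : MeasurePreserving ρ volume volume := by
    refine volume_preserving_pi (f := fun i (u : ℝ) => if ε i then u else -u) fun i => ?_
    by_cases h : ε i
    · simp only [h, if_true]
      exact MeasurePreserving.id volume
    · simpa [h] using Measure.measurePreserving_neg (volume : Measure ℝ)
  have hnull : ∀ a : ℝ, NullMeasurableSet (f ⁻¹' Set.Ici a) (volume.restrict (Set.univ.pi S)) := by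
    intro a
    -- The upper set generated by the reflected superlevel set.
    let U : Set (ι → ℝ) := {z | ∃ y ∈ Set.univ.pi S, a ≤ f y ∧ ρ y ≤ z}
    have hU : IsUpperSet U := fun z w hzw ⟨y, hy, hay, hyz⟩ => ⟨y, hy, hay, hyz.trans hzw⟩
    have hUm : NullMeasurableSet (ρ ⁻¹' U) volume :=
      hU.ordConnected.nullMeasurableSet.preimage hρ.quasiMeasurePreserving
    have heq : f ⁻¹' Set.Ici a ∩ Set.univ.pi S = ρ ⁻¹' U ∩ Set.univ.pi S := by
      ext x
      constructor
      · rintro ⟨hx, hxS⟩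
        exact ⟨⟨x, hxS, hx, le_rfl⟩, hxS⟩
      · rintro ⟨⟨y, hyS, hay, hyx⟩, hxS⟩
        refine ⟨hay.trans (le_of_forall_update_le hf' hyS hxS fun i => ?_), hxS⟩
        have := hyx i
        simp only [ρ] at this
        split_ifs at this ⊢
        · exact this
        · linarith
    rw [nullMeasurableSet_restrict hSm.nullMeasurableSet, heq]
    exact hUm.inter hSm.nullMeasurableSet
  have hnm : NullMeasurable f (volume.restrict (Set.univ.pi S)) :=
    measurable_of_Ici (δ := NullMeasurableSpace (ι → ℝ) (volume.restrict (Set.univ.pi S))) hnull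
  exact hnm.aemeasurable

/-! ### Stratified uniform offsets -/

theorem uniformPerm_singleton {n : ℕ} (π : Equiv.Perm (Fin n)) :
    uniformPerm n {π} = (Fintype.card (Equiv.Perm (Fin n)) : ℝ≥0∞)⁻¹ := by
  classical
  rw [uniformPerm, uniformOn_univ, Measure.count_singleton, one_div]

/-- Splitting `[0,1)` into `t` strata of equal length: the measure of a set is the average over the
strata of the measures of its traces, each rescaled to `[0,1)`. -/
theorem sum_uniformUnit_preimage_stratum {t : ℕ} (ht : 0 < t) {S : Set ℝ} (hS : MeasurableSet S) :
    ∑ j : Fin t, uniformUnit ((fun u : ℝ => (((j : ℕ) : ℝ) + u) / t) ⁻¹' S) =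
      t * uniformUnit S := by
  have ht' : (0 : ℝ) < t := Nat.cast_pos.2 ht
  -- The stratum number `j` of `[0,1)`.
  let I : Fin t → Set ℝ := fun j => {x | ⌊t * x⌋ = ((j : ℕ) : ℤ)}
  have hI : ∀ j, MeasurableSet (I j) := fun j =>
    (Int.measurable_floor.comp (measurable_const_mul (t : ℝ))) (measurableSet_singleton _)
  have hdisj : Pairwise (Function.onFun Disjoint fun j => S ∩ I j) := by
    intro j j' hjj'
    refine Set.disjoint_left.2 fun x hx hx' => hjj' ?_
    have := hx.2.symm.trans hx'.2
    exact Fin.ext (by exact_mod_cast this)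
  have hunion : S ∩ Set.Ico 0 1 = ⋃ j, S ∩ I j := by
    ext x
    simp only [Set.mem_inter_iff, Set.mem_Ico, Set.mem_iUnion, I, Set.mem_ofPred_eq]
    constructor
    · rintro ⟨hxS, hx0, hx1⟩
      have h0 : 0 ≤ ⌊t * x⌋ := Int.floor_nonneg.2 (by positivity)
      have h1 : ⌊t * x⌋ < t := Int.floor_lt.2 (by push_cast; nlinarith)
      exact ⟨⟨⌊t * x⌋.toNat, by omega⟩, hxS, by simp [h0]⟩
    · rintro ⟨j, hxS, hj⟩
      have hj1 : ((j : ℕ) : ℝ) + 1 ≤ t := by exact_mod_cast j.2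
      rw [Int.floor_eq_iff] at hj
      push_cast at hj
      have hj0 : (0 : ℝ) ≤ ((j : ℕ) : ℝ) := Nat.cast_nonneg _
      refine ⟨hxS, ?_, ?_⟩
      · by_contra h; push Not at h; nlinarith
      · by_contra h; push Not at h; nlinarith
  have hmap : ∀ j : Fin t, uniformUnit ((fun u : ℝ => (((j : ℕ) : ℝ) + u) / t) ⁻¹' S) =
      t * volume (S ∩ I j) := by
    intro j
    have hm : Measurable fun u : ℝ => (((j : ℕ) : ℝ) + u) / t := by fun_prop
    rw [uniformUnit, Measure.restrict_apply (hm hS)]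
    have hset : (fun u : ℝ => (((j : ℕ) : ℝ) + u) / t) ⁻¹' S ∩ Set.Ico 0 1 =
        (fun u => ((j : ℕ) : ℝ) + u) ⁻¹' ((fun u : ℝ => u * (t : ℝ)⁻¹) ⁻¹' (S ∩ I j)) := by
      ext u
      have : (t : ℝ) * ((((j : ℕ) : ℝ) + u) / t) = ((j : ℕ) : ℝ) + u := by field_simp
      simp only [Set.mem_inter_iff, Set.mem_preimage, I, Set.mem_ofPred_eq, ← div_eq_mul_inv, this,
        Set.mem_Ico, Int.floor_eq_iff]
      push_cast
      constructor
      · rintro ⟨h, h0, h1⟩; exact ⟨h, by linarith, by linarith⟩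
      · rintro ⟨h, h0, h1⟩; exact ⟨h, by linarith, by linarith⟩
    rw [hset, measure_preimage_add, Real.volume_preimage_mul_right (inv_ne_zero ht'.ne'), inv_inv,
      abs_of_pos ht', ENNReal.ofReal_natCast]
  rw [Finset.sum_congr rfl fun j _ => hmap j, ← Finset.mul_sum, uniformUnit,
    Measure.restrict_apply hS, hunion, measure_iUnion hdisj fun j => hS.inter (hI j), tsum_fintype]

/-- A uniform offset in `[0,1)`, placed into the stratum of `[0,1)` chosen by a uniform
permutation, is uniform on `[0,1)`. Strata are numbered from right to left, because offsets are
subtracted in the definition of a design. -/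
theorem measurePreserving_stratifiedOffset {t : ℕ} (r : Fin t) :
    MeasurePreserving (fun z : Equiv.Perm (Fin t) × ℝ => ((t : ℝ) - 1 - (z.1 r : ℕ) + z.2) / t)
      ((uniformPerm t).prod uniformUnit) uniformUnit := by
  have ht : 0 < t := r.pos
  have hm : Measurable fun z : Equiv.Perm (Fin t) × ℝ =>
      ((t : ℝ) - 1 - (z.1 r : ℕ) + z.2) / t := by
    have h1 : Measurable fun z : Equiv.Perm (Fin t) × ℝ => ((z.1 r : ℕ) : ℝ) :=
      (Measurable.of_discrete (f := fun p : Equiv.Perm (Fin t) => ((p r : ℕ) : ℝ))).comp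
        measurable_fst
    fun_prop
  refine ⟨hm, Measure.ext fun S hS => ?_⟩
  rw [Measure.map_apply hm hS, Measure.prod_apply (hm hS), lintegral_fintype]
  simp only [uniformPerm_singleton, ← Set.preimage_comp]
  rw [← Finset.sum_mul]
  let g : Fin t → ℝ≥0∞ := fun j =>
    uniformUnit ((fun u : ℝ => (((j : ℕ) : ℝ) + u) / t) ⁻¹' S)
  have hg : ∀ p : Equiv.Perm (Fin t), uniformUnit
      ((fun z : Equiv.Perm (Fin t) × ℝ => ((t : ℝ) - 1 - (z.1 r : ℕ) + z.2) / t) ∘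
        Prod.mk p ⁻¹' S) = g (Fin.rev (p r)) := by
    intro p
    have : (((Fin.rev (p r) : Fin t) : ℕ) : ℝ) = (t : ℝ) - 1 - (p r : ℕ) := by
      rw [Fin.val_rev, Nat.cast_sub (p r).2]; push_cast; ring
    simp only [g, this]
    rfl
  rw [Finset.sum_congr rfl fun p _ => hg p]
  -- All points `a` give the same sum, and together they run through all strata.
  have hone : ∀ a : Fin t, ∑ p : Equiv.Perm (Fin t), g (Fin.rev (p a)) =
      ∑ p : Equiv.Perm (Fin t), g (Fin.rev (p r)) := by
    intro a
    rw [← Equiv.sum_comp (Equiv.mulRight (Equiv.swap a r))]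
    simp
  have htot : (t : ℝ≥0∞) * ∑ p : Equiv.Perm (Fin t), g (Fin.rev (p r)) =
      (Fintype.card (Equiv.Perm (Fin t))) * (t * uniformUnit S) := by
    rw [← sum_uniformUnit_preimage_stratum ht hS]
    have h1 : ∑ a : Fin t, ∑ p : Equiv.Perm (Fin t), g (Fin.rev (p a)) =
        t * ∑ p : Equiv.Perm (Fin t), g (Fin.rev (p r)) := by
      rw [Finset.sum_congr rfl fun a _ => hone a]; simp
    have h2 : ∀ p : Equiv.Perm (Fin t), ∑ a : Fin t, g (Fin.rev (p a)) = ∑ j, g j := fun p =>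
      Equiv.sum_comp (p.trans Fin.revPerm) g
    rw [← h1, Finset.sum_comm, Finset.sum_congr rfl fun p _ => h2 p]
    simp [g]
  have ht0 : (t : ℝ≥0∞) ≠ 0 := by exact_mod_cast ht.ne'
  have hc0 : (Fintype.card (Equiv.Perm (Fin t)) : ℝ≥0∞) ≠ 0 := by
    exact_mod_cast Fintype.card_ne_zero
  have hmain : ∑ p : Equiv.Perm (Fin t), g (Fin.rev (p r)) =
      Fintype.card (Equiv.Perm (Fin t)) * uniformUnit S := by
    rw [mul_left_comm] at htot
    exact (ENNReal.mul_right_inj ht0 (ENNReal.natCast_ne_top t)).1 htot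
  rw [hmain, mul_comm, ← mul_assoc, ENNReal.inv_mul_cancel hc0 (ENNReal.natCast_ne_top _), one_mul]

/-! ### Marginal laws of the slices -/

/-- A measure on matrices that gives each box the product mass is the law of independent identically
distributed entries. -/
theorem pi_pi_eq_of_box {ι κ α : Type*} [Fintype ι] [Fintype κ] [MeasurableSpace α]
    (μ : Measure α) [IsProbabilityMeasure μ] {ν : Measure (ι → κ → α)}
    (h : ∀ s : ι → κ → Set α, (∀ i k, MeasurableSet (s i k)) →
      ν (Set.univ.pi fun i => Set.univ.pi (s i)) = ∏ i, ∏ k, μ (s i k)) :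
    Measure.pi (fun _ : ι => Measure.pi fun _ : κ => μ) = ν := by
  refine Measure.pi_eq_generateFrom (C := fun _ => Set.univ.pi '' Set.univ.pi fun _ =>
    {s : Set α | MeasurableSet s}) (fun _ => generateFrom_pi) (fun _ => isPiSystem_pi)
    (fun _ => Measure.FiniteSpanningSetsIn.pi fun _ => μ.toFiniteSpanningSetsIn) ?_
  intro s hs
  choose S hS hSs using hs
  have : s = fun i => Set.univ.pi (S i) := funext fun i => (hSs i).symm
  subst this
  rw [h S fun i k => hS i k trivial]
  simp [Measure.pi_pi]

/-- Transposing a matrix of independent identically distributed entries and permuting the entries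
within each column gives a matrix with the same law. -/
theorem measurePreserving_permuteEntries {ι κ α : Type*} [Fintype ι] [Fintype κ]
    [MeasurableSpace α] (μ : Measure α) [IsProbabilityMeasure μ] (B : κ → Equiv.Perm ι) :
    MeasurePreserving (fun (x : κ → ι → α) (i : ι) (k : κ) => x k (B k i))
      (Measure.pi fun _ => Measure.pi fun _ => μ) (Measure.pi fun _ => Measure.pi fun _ => μ) := by
  have hm : Measurable fun (x : κ → ι → α) (i : ι) (k : κ) => x k (B k i) := by fun_prop
  refine ⟨hm, (pi_pi_eq_of_box μ fun s hs => ?_).symm⟩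
  rw [Measure.map_apply hm (.univ_pi fun i => .univ_pi fun k => hs i k)]
  have hset : (fun (x : κ → ι → α) (i : ι) (k : κ) => x k (B k i)) ⁻¹'
      (Set.univ.pi fun i => Set.univ.pi (s i)) =
      Set.univ.pi fun k => Set.univ.pi fun l => s ((B k).symm l) k := by
    ext x
    simp only [Set.mem_preimage, Set.mem_univ_pi]
    constructor
    · intro h k l; simpa using h ((B k).symm l) k
    · intro h i k; simpa using h k (B k i)
  rw [hset]
  simp only [Measure.pi_pi]
  conv_rhs => rw [Finset.prod_comm]
  exact Finset.prod_congr rfl fun k _ => Equiv.prod_comp (B k).symm fun i => μ (s i k)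

/-- For each Latin hypercube, the offsets of a slice within the levels of the hypercube are again
independent and uniform. -/
theorem measurePreserving_sliceOffset {n m t : ℕ} (r : Fin t) (B : LatinHypercube n m) :
    MeasurePreserving
      (fun (z : (Fin m → Fin n → Equiv.Perm (Fin t)) × (Fin n → Fin m → ℝ)) (i : Fin n)
        (k : Fin m) => ((t : ℝ) - 1 - (z.1 k (B k i) r : ℕ) + z.2 i k) / t)
      ((Measure.pi fun _ => Measure.pi fun _ => uniformPerm t).prod (jitterLaw n m))
      (jitterLaw n m) := by
  have h1 : MeasurePreserving
      (fun (z : (Fin m → Fin n → Equiv.Perm (Fin t)) × (Fin n → Fin m → ℝ)) =>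
        ((fun (i : Fin n) (k : Fin m) => z.1 k (B k i)), z.2))
      ((Measure.pi fun _ => Measure.pi fun _ => uniformPerm t).prod (jitterLaw n m))
      ((Measure.pi fun _ => Measure.pi fun _ => uniformPerm t).prod (jitterLaw n m)) :=
    (measurePreserving_permuteEntries (uniformPerm t) B).prod
      (MeasurePreserving.id (jitterLaw n m))
  have h2 : MeasurePreserving
      (fun (z : (Fin n → Fin m → Equiv.Perm (Fin t)) × (Fin n → Fin m → ℝ)) (i : Fin n) =>
        (z.1 i, z.2 i))
      ((Measure.pi fun _ => Measure.pi fun _ => uniformPerm t).prod (jitterLaw n m))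
      (Measure.pi fun _ => (Measure.pi fun _ => uniformPerm t).prod
        (Measure.pi fun _ => uniformUnit)) :=
    (measurePreserving_arrowProdEquivProdArrow (Fin m → Equiv.Perm (Fin t)) (Fin m → ℝ)
      (Fin n) (fun _ => Measure.pi fun _ => uniformPerm t) fun _ =>
        Measure.pi fun _ => uniformUnit).symm
  have h3 : MeasurePreserving
      (fun (z : Fin n → (Fin m → Equiv.Perm (Fin t)) × (Fin m → ℝ)) (i : Fin n) (k : Fin m) =>
        ((t : ℝ) - 1 - ((z i).1 k r : ℕ) + (z i).2 k) / t)
      (Measure.pi fun _ => (Measure.pi fun _ => uniformPerm t).prod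
        (Measure.pi fun _ => uniformUnit)) (jitterLaw n m) := by
    refine measurePreserving_pi _ _ (f := fun _ (z : (Fin m → Equiv.Perm (Fin t)) × (Fin m → ℝ))
      (k : Fin m) => ((t : ℝ) - 1 - (z.1 k r : ℕ) + z.2 k) / t) fun i => ?_
    have h4 : MeasurePreserving
        (fun (z : (Fin m → Equiv.Perm (Fin t)) × (Fin m → ℝ)) (k : Fin m) => (z.1 k, z.2 k))
        ((Measure.pi fun _ => uniformPerm t).prod (Measure.pi fun _ => uniformUnit))
        (Measure.pi fun _ => (uniformPerm t).prod uniformUnit) :=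
      (measurePreserving_arrowProdEquivProdArrow (Equiv.Perm (Fin t)) ℝ
        (Fin m) (fun _ => uniformPerm t) fun _ => uniformUnit).symm
    exact (measurePreserving_pi (fun _ : Fin m => (uniformPerm t).prod uniformUnit)
      (fun _ => uniformUnit) fun _ => measurePreserving_stratifiedOffset r).comp h4
  have h21 := h2.comp h1
  have h5 := h3.comp h21
  simp only [Function.comp_def] at h5
  exact h5

/-! ### Slices given their strata -/

/-- The joint law of the permutations that refine the levels in sliced sampling. -/
def strataLaw (n m t : ℕ) : Measure (Fin m → Fin n → Equiv.Perm (Fin t)) :=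
  Measure.pi fun _ => Measure.pi fun _ => uniformPerm t

/-- The joint law of a Latin hypercube and of its offsets. -/
def cellLaw (n m : ℕ) : Measure (LatinHypercube n m × (Fin n → Fin m → ℝ)) :=
  (latinHypercubeLaw n m).prod (jitterLaw n m)

instance strataLaw_isProbabilityMeasure (n m t : ℕ) : IsProbabilityMeasure (strataLaw n m t) := by
  unfold strataLaw; infer_instance

instance cellLaw_isProbabilityMeasure (n m : ℕ) : IsProbabilityMeasure (cellLaw n m) := by
  unfold cellLaw; infer_instance

/-- The slice built from a Latin hypercube and its offsets, when level `ℓ` of column `k` is placed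
into the stratum number `c k ℓ` among the `t` strata of that level. -/
def sliceDesign {n m t : ℕ} (c : Fin m → Fin n → Fin t)
    (z : LatinHypercube n m × (Fin n → Fin m → ℝ)) : Design n m :=
  lhDesign (z.1, fun i k => ((t : ℝ) - 1 - (c k (z.1 k i) : ℕ) + z.2 i k) / t)

theorem slhDesign_apply_eq_sliceDesign {n m t : ℕ} (s : SlhInput n m t) (r : Fin t) :
    slhDesign s r = sliceDesign (fun k l => s.2.1 k l r) (s.1 r, s.2.2 r) := by
  have ht : (t : ℝ) ≠ 0 := Nat.cast_ne_zero.2 r.pos.ne'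
  funext i k
  simp only [slhDesign, sliceDesign, lhDesign, slhEntry]
  rw [mul_comm (n : ℝ), ← div_div]
  congr 1
  push_cast
  field_simp
  ring

theorem measurePreserving_leftComm {α β γ : Type*} [MeasurableSpace α] [MeasurableSpace β]
    [MeasurableSpace γ] (μ : Measure α) (ν : Measure β) (τ : Measure γ) [SFinite μ] [SFinite ν]
    [SFinite τ] :
    MeasurePreserving (fun z : α × (β × γ) => (z.2.1, (z.1, z.2.2)))
      (μ.prod (ν.prod τ)) (ν.prod (μ.prod τ)) :=
  (measurePreserving_prodAssoc _ _ _).comp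
    ((Measure.measurePreserving_swap.prod (MeasurePreserving.id τ)).comp
      (measurePreserving_prodAssoc _ _ _).symm)

/-- Averaged over the strata, each slice is an ordinary Latin hypercube design. -/
theorem measurePreserving_sliceDesign {n m t : ℕ} (r : Fin t) :
    MeasurePreserving
      (fun z : (Fin m → Fin n → Equiv.Perm (Fin t)) × (LatinHypercube n m × (Fin n → Fin m → ℝ)) =>
        sliceDesign (fun k l => z.1 k l r) z.2)
      ((strataLaw n m t).prod (cellLaw n m)) (lhLaw n m) := by
  have h1 : MeasurePreserving
      (fun z : LatinHypercube n m × ((Fin m → Fin n → Equiv.Perm (Fin t)) × (Fin n → Fin m → ℝ)) =>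
        (z.1, fun (i : Fin n) (k : Fin m) =>
          ((t : ℝ) - 1 - (z.2.1 k (z.1 k i) r : ℕ) + z.2.2 i k) / t))
      ((latinHypercubeLaw n m).prod ((strataLaw n m t).prod (jitterLaw n m))) (cellLaw n m) := by
    refine (MeasurePreserving.id (latinHypercubeLaw n m)).skew_product
      (g := fun B (z : (Fin m → Fin n → Equiv.Perm (Fin t)) × (Fin n → Fin m → ℝ)) (i : Fin n)
        (k : Fin m) => ((t : ℝ) - 1 - (z.1 k (B k i) r : ℕ) + z.2 i k) / t) ?_
      (ae_of_all _ fun B => (measurePreserving_sliceOffset r B).map_eq)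
    refine measurable_pi_lambda _ fun i => measurable_pi_lambda _ fun k => ?_
    have h2 : Measurable fun z : LatinHypercube n m ×
        ((Fin m → Fin n → Equiv.Perm (Fin t)) × (Fin n → Fin m → ℝ)) =>
          ((z.2.1 k (z.1 k i) r : ℕ) : ℝ) :=
      (Measurable.of_discrete (f := fun q : LatinHypercube n m ×
        (Fin m → Fin n → Equiv.Perm (Fin t)) => ((q.2 k (q.1 k i) r : ℕ) : ℝ))).comp
          (measurable_fst.prodMk measurable_snd.fst)
    simp only [Function.uncurry]
    fun_prop
  have h2 : MeasurePreserving (fun z : (Fin m → Fin n → Equiv.Perm (Fin t)) ×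
      (LatinHypercube n m × (Fin n → Fin m → ℝ)) => (z.2.1, (z.1, z.2.2)))
      ((strataLaw n m t).prod (cellLaw n m))
      ((latinHypercubeLaw n m).prod ((strataLaw n m t).prod (jitterLaw n m))) :=
    measurePreserving_leftComm _ _ _
  have h3 : MeasurePreserving lhDesign (cellLaw n m) (lhLaw n m) := ⟨measurable_lhDesign, rfl⟩
  exact h3.comp (h1.comp h2)

/-- The slices, as functions of the strata and of independent Latin hypercubes with offsets. -/
theorem measurePreserving_sliceDesigns (n m t : ℕ) :
    MeasurePreserving
      (fun (z : (Fin m → Fin n → Equiv.Perm (Fin t)) ×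
          (Fin t → LatinHypercube n m × (Fin n → Fin m → ℝ))) (r : Fin t) =>
        sliceDesign (fun k l => z.1 k l r) (z.2 r))
      ((strataLaw n m t).prod (Measure.pi fun _ => cellLaw n m)) (slhLaw n m t) := by
  have h1 : MeasurePreserving (slhDesign (n := n) (m := m) (t := t)) (slhInputLaw n m t)
      (slhLaw n m t) := ⟨measurable_slhDesign, rfl⟩
  have h2 : MeasurePreserving
      (fun z : Fin t → LatinHypercube n m × (Fin n → Fin m → ℝ) =>
        ((fun r => (z r).1), fun r => (z r).2))
      (Measure.pi fun _ => cellLaw n m)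
      ((Measure.pi fun _ => latinHypercubeLaw n m).prod (Measure.pi fun _ => jitterLaw n m)) :=
    measurePreserving_arrowProdEquivProdArrow (LatinHypercube n m) (Fin n → Fin m → ℝ) (Fin t)
      (fun _ => latinHypercubeLaw n m) fun _ => jitterLaw n m
  have h3 : MeasurePreserving (fun z : (Fin m → Fin n → Equiv.Perm (Fin t)) ×
      ((Fin t → LatinHypercube n m) × (Fin t → Fin n → Fin m → ℝ)) => (z.2.1, (z.1, z.2.2)))
      ((strataLaw n m t).prod
        ((Measure.pi fun _ => latinHypercubeLaw n m).prod (Measure.pi fun _ => jitterLaw n m)))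
      (slhInputLaw n m t) := measurePreserving_leftComm _ _ _
  have h5 := h3.comp ((MeasurePreserving.id (strataLaw n m t)).prod h2)
  have h4 := h1.comp h5
  simp only [Function.comp_def, Prod.map, id] at h4
  have h6 : (fun (z : (Fin m → Fin n → Equiv.Perm (Fin t)) ×
      (Fin t → LatinHypercube n m × (Fin n → Fin m → ℝ))) (r : Fin t) =>
        sliceDesign (fun k l => z.1 k l r) (z.2 r)) =
      fun z => slhDesign (fun r => (z.2 r).1, z.1, fun r => (z.2 r).2) := by
    funext z r
    rw [slhDesign_apply_eq_sliceDesign]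
  rw [h6]
  exact h4

theorem measurePreserving_eval_slhLaw {n m t : ℕ} (r : Fin t) :
    MeasurePreserving (fun D : Fin t → Design n m => D r) (slhLaw n m t) (lhLaw n m) := by
  have h := (measurePreserving_sliceDesign (n := n) (m := m) r).comp
    ((MeasurePreserving.id (strataLaw n m t)).prod
      (measurePreserving_eval (fun _ : Fin t => cellLaw n m) r))
  refine ⟨measurable_pi_apply r, ?_⟩
  rw [← (measurePreserving_sliceDesigns n m t).map_eq,
    Measure.map_map (measurable_pi_apply r) (measurePreserving_sliceDesigns n m t).measurable]
  exact h.map_eq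

theorem strataLaw_singleton {n m t : ℕ} (π : Fin m → Fin n → Equiv.Perm (Fin t)) :
    strataLaw n m t {π} =
      (Fintype.card (Fin m × Fin n → Equiv.Perm (Fin t)) : ℝ≥0∞)⁻¹ := by
  classical
  rw [strataLaw, Measure.pi_singleton]
  simp only [Measure.pi_singleton, uniformPerm_singleton]
  simp [ENNReal.inv_pow, pow_mul, mul_comm m n]

theorem integral_strataLaw {n m t : ℕ} (Φ : (Fin m → Fin n → Equiv.Perm (Fin t)) → ℝ) :
    ∫ π, Φ π ∂(strataLaw n m t) =
      (Fintype.card (Fin m × Fin n → Equiv.Perm (Fin t)) : ℝ)⁻¹ *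
        ∑ π : Fin m × Fin n → Equiv.Perm (Fin t), Φ (Function.curry π) := by
  classical
  rw [integral_fintype .of_finite, Finset.mul_sum,
    ← Equiv.sum_comp (Equiv.curry (Fin m) (Fin n) (Equiv.Perm (Fin t)))]
  refine Finset.sum_congr rfl fun π _ => ?_
  rw [measureReal_def, strataLaw_singleton]
  simp [Equiv.curry]

/-! ### Consequences of monotonicity -/

theorem apply_lhDesign_eq_offsetValue {n m : ℕ} (v : Design n m → ℝ) (B : LatinHypercube n m)
    (γ : Fin n → Fin m → ℝ) :
    v (lhDesign (B, γ)) = offsetValue v B (fun l k => γ ((B k).symm l) k) := by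
  simp only [offsetValue, Equiv.symm_apply_apply]
  rfl

theorem measurePreserving_curry_jitterLaw (n m : ℕ) :
    MeasurePreserving (MeasurableEquiv.curry (Fin n) (Fin m) ℝ)
      (volume.restrict (Set.univ.pi fun _ => Set.Ico (0 : ℝ) 1)) (jitterLaw n m) := by
  refine ⟨(MeasurableEquiv.curry (Fin n) (Fin m) ℝ).measurable, ?_⟩
  refine (pi_pi_eq_of_box uniformUnit fun s hs => ?_).symm
  rw [MeasurableEquiv.map_apply, volume_pi, Measure.restrict_pi_pi]
  have hset : MeasurableEquiv.curry (Fin n) (Fin m) ℝ ⁻¹'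
      (Set.univ.pi fun i => Set.univ.pi (s i)) = Set.univ.pi fun q => s q.1 q.2 := by
    ext x
    simp [MeasurableEquiv.curry]
  rw [hset, Measure.pi_pi, Fintype.prod_prod_type]
  rfl

/-- On the cell of a fixed Latin hypercube, a monotonic function is measurable with respect to the
law of the offsets. -/
theorem IsMonotonic.aemeasurable_cell {n m : ℕ} {v : Design n m → ℝ} (hv : IsMonotonic v)
    (B : LatinHypercube n m) :
    AEMeasurable (fun γ => v (lhDesign (B, γ))) (jitterLaw n m) := by
  classical
  rw [← (measurePreserving_curry_jitterLaw n m).map_eq, aemeasurable_map_equiv_iff]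
  refine aemeasurable_of_coordinatewise_monotone (fun _ => measurableSet_Ico) ?_
  rintro ⟨i, k⟩
  have hupd : ∀ (x : Fin n × Fin m → ℝ) (s : ℝ),
      ((fun γ => v (lhDesign (B, γ))) ∘ MeasurableEquiv.curry (Fin n) (Fin m) ℝ)
        (Function.update x (i, k) s) =
      offsetValue v B (replaceEntry (fun l q => x ((B q).symm l, q)) (B k i) k s) := by
    intro x s
    simp only [Function.comp_apply, apply_lhDesign_eq_offsetValue]
    congr 1
    funext l q
    simp only [MeasurableEquiv.curry, MeasurableEquiv.coe_mk, Equiv.curry_apply, Function.curry,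
      replaceEntry, Function.update_apply, Prod.mk.injEq]
    by_cases hq : q = k
    · subst hq
      by_cases hl : l = B q i
      · subst hl; simp
      · have : (B q).symm l ≠ i := fun h => hl (by rw [← h]; simp)
        simp [hl, this]
    · by_cases hl : l = B k i <;> simp [hq, hl]
  simp only [hupd]
  rcases hv (B k i) k with h | h
  · exact Or.inl fun x hx => h B _ fun l q => hx _ trivial
  · exact Or.inr fun x hx => h B _ fun l q => hx _ trivial

/-- The law of an ordinary design is a finite mixture of laws on the cells of Latin hypercubes, and
each cell is parametrized injectively by the offsets. -/
theorem IsMonotonic.aemeasurable {n m : ℕ} {v : Design n m → ℝ} (hv : IsMonotonic v) :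
    AEMeasurable v (lhLaw n m) := by
  have hmeas : ∀ B : LatinHypercube n m,
      Measurable fun γ : Fin n → Fin m → ℝ => lhDesign (B, γ) := fun B =>
    measurable_lhDesign.comp (measurable_const.prodMk measurable_id)
  have hemb : ∀ B : LatinHypercube n m,
      MeasurableEmbedding fun γ : Fin n → Fin m → ℝ => lhDesign (B, γ) := by
    refine fun B => (hmeas B).measurableEmbedding fun γ γ' h => ?_
    funext i k
    have hn : (n : ℝ) ≠ 0 := Nat.cast_ne_zero.2 i.pos.ne'
    have h' := congrFun (congrFun h i) k
    simp only [lhDesign, div_left_inj' hn] at h'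
    linarith
  have hsum : AEMeasurable v (Measure.sum fun B : LatinHypercube n m =>
      (jitterLaw n m).map fun γ => lhDesign (B, γ)) := by
    rw [aemeasurable_sum_measure_iff]
    exact fun B => (hemb B).aemeasurable_map_iff.2 (hv.aemeasurable_cell B)
  refine hsum.mono_ac (Measure.AbsolutelyContinuous.mk fun S hS h0 => ?_)
  rw [Measure.sum_apply_eq_zero] at h0
  rw [lhLaw, Measure.map_apply measurable_lhDesign hS,
    Measure.prod_apply (measurable_lhDesign hS)]
  refine lintegral_eq_zero_of_ae_eq_zero (ae_of_all _ fun B => ?_)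
  have := h0 B
  rwa [Measure.map_apply (hmeas B) hS] at this

theorem ae_jitterLaw_mem_Ico (n m : ℕ) :
    ∀ᵐ γ ∂(jitterLaw n m), ∀ i k, γ i k ∈ Set.Ico (0 : ℝ) 1 := by
  have h1 : ∀ᵐ u ∂uniformUnit, u ∈ Set.Ico (0 : ℝ) 1 := ae_restrict_mem measurableSet_Ico
  rw [ae_all_iff]; intro i
  rw [ae_all_iff]; intro k
  have h2 := (measurePreserving_eval (fun _ : Fin m => uniformUnit) k).comp
    (measurePreserving_eval (fun _ : Fin n => Measure.pi fun _ : Fin m => uniformUnit) i)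
  exact h2.quasiMeasurePreserving.ae h1

/-- The expected value of `v` on a slice, given the strata of its levels. -/
def strataMean {n m t : ℕ} (v : Design n m → ℝ) (c : Fin m × Fin n → Fin t) : ℝ :=
  ∫ z, v (sliceDesign (Function.curry c) z) ∂(cellLaw n m)

/-- A function that is integrable for the law of an ordinary design stays integrable given any
choice of the strata, because each choice has positive probability. -/
theorem integrable_sliceDesign {n m t : ℕ} {v : Design n m → ℝ} (hv : Integrable v (lhLaw n m))
    (r : Fin t) (c : Fin m → Fin n → Fin t) :
    Integrable (fun z => v (sliceDesign c z)) (cellLaw n m) := by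
  have h := ((measurePreserving_sliceDesign r).integrable_comp_of_integrable hv).prod_right_ae
  rw [ae_iff_of_countable] at h
  -- The strata `c` arise at the point `r` from the transpositions of `r` and `c k l`.
  have h1 := h (fun k l => Equiv.swap r (c k l)) (by
    rw [strataLaw_singleton]
    exact ENNReal.inv_ne_zero.2 (ENNReal.natCast_ne_top _))
  simpa using h1

theorem IsMonotonic.similarlyMonotone_strataMean {n m t : ℕ} {v : Design n m → ℝ}
    (hv : IsMonotonic v) (hvi : Integrable v (lhLaw n m)) (r : Fin t) :
    SimilarlyMonotone (strataMean (t := t) v) (strataMean v) := by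
  classical
  have ht : (0 : ℝ) < t := Nat.cast_pos.2 r.pos
  let Δ : (Fin m × Fin n → Fin t) → LatinHypercube n m → (Fin n → Fin m → ℝ) →
    Fin n → Fin m → ℝ := fun c B γ l k =>
      ((t : ℝ) - 1 - (c (k, l) : ℕ) + γ ((B k).symm l) k) / t
  have hrange : ∀ (a : Fin t) (u : ℝ), u ∈ Set.Ico (0 : ℝ) 1 →
      ((t : ℝ) - 1 - (a : ℕ) + u) / t ∈ Set.Ico (0 : ℝ) 1 := by
    intro a u hu
    have ha : ((a : ℕ) : ℝ) + 1 ≤ t := by exact_mod_cast a.2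
    have ha0 : (0 : ℝ) ≤ ((a : ℕ) : ℝ) := Nat.cast_nonneg _
    exact ⟨div_nonneg (by linarith [hu.1]) ht.le, (div_lt_one ht).2 (by linarith [hu.2])⟩
  have hval : ∀ (c : Fin m × Fin n → Fin t) (z : LatinHypercube n m × (Fin n → Fin m → ℝ)),
      v (sliceDesign (Function.curry c) z) = offsetValue v z.1 (Δ c z.1 z.2) := by
    intro c z
    simp [sliceDesign, apply_lhDesign_eq_offsetValue, Δ, Function.curry]
  have hupd : ∀ (c : Fin m × Fin n → Fin t) (k : Fin m) (l : Fin n) (a : Fin t)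
      (B : LatinHypercube n m) (γ : Fin n → Fin m → ℝ), Δ (Function.update c (k, l) a) B γ =
        replaceEntry (Δ c B γ) l k (((t : ℝ) - 1 - (a : ℕ) + γ ((B k).symm l) k) / t) := by
    intro c k l a B γ
    funext l' k'
    simp only [Δ, replaceEntry, Function.update_apply, Prod.mk.injEq]
    by_cases hk : k' = k
    · subst hk
      by_cases hl : l' = l
      · subst hl; simp
      · simp [hl]
    · by_cases hl : l' = l <;> simp [hk, hl]
  have hae : ∀ᵐ z ∂(cellLaw n m), ∀ i k, z.2 i k ∈ Set.Ico (0 : ℝ) 1 :=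
    (Measure.quasiMeasurePreserving_snd (μ := latinHypercubeLaw n m)).ae (ae_jitterLaw_mem_Ico n m)
  rintro ⟨k, l⟩
  -- A larger stratum number means a smaller offset, so the directions are reversed.
  have hle : ∀ {a b : Fin t}, a ≤ b → ∀ u : ℝ,
      ((t : ℝ) - 1 - (b : ℕ) + u) / t ≤ ((t : ℝ) - 1 - (a : ℕ) + u) / t := by
    intro a b hab u
    have : ((a : ℕ) : ℝ) ≤ ((b : ℕ) : ℝ) := by exact_mod_cast hab
    gcongr
  rcases hv l k with h | h
  · have hA : ∀ c : Fin m × Fin n → Fin t,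
        Antitone fun a => strataMean v (Function.update c (k, l) a) := by
      intro c a b hab
      refine integral_mono_ae (integrable_sliceDesign hvi r _) (integrable_sliceDesign hvi r _) ?_
      filter_upwards [hae] with z hz
      rw [hval, hval, hupd, hupd]
      exact h z.1 _ (fun l' k' => hrange _ _ (hz _ _)) (hrange _ _ (hz _ _)) (hrange _ _ (hz _ _))
        (hle hab _)
    exact Or.inr ⟨hA, hA⟩
  · have hM : ∀ c : Fin m × Fin n → Fin t,
        Monotone fun a => strataMean v (Function.update c (k, l) a) := by
      intro c a b hab
      refine integral_mono_ae (integrable_sliceDesign hvi r _) (integrable_sliceDesign hvi r _) ?_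
      filter_upwards [hae] with z hz
      rw [hval, hval, hupd, hupd]
      exact h z.1 _ (fun l' k' => hrange _ _ (hz _ _)) (hrange _ _ (hz _ _)) (hrange _ _ (hz _ _))
        (hle hab _)
    exact Or.inl ⟨hM, hM⟩

/-! ### Covariances of the slices and variances of the estimators -/

/-- Given the strata, two slices are independent, so the covariance of their values is that of the
conditional means; these are coordinatewise monotone functions of negatively dependent strata. -/
theorem IsMonotonic.covariance_slices_nonpos {n m t : ℕ} {v : Design n m → ℝ} (hv : IsMonotonic v)
    (hv2 : MemLp v 2 (lhLaw n m)) {r s : Fin t} (hrs : r ≠ s) :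
    cov[fun D : Fin t → Design n m => v (D r), fun D => v (D s); slhLaw n m t] ≤ 0 := by
  have hvi : Integrable v (lhLaw n m) := hv2.integrable one_le_two
  have hmem : ∀ q : Fin t, MemLp (fun D : Fin t → Design n m => v (D q)) 2 (slhLaw n m t) :=
    fun q => hv2.comp_measurePreserving (measurePreserving_eval_slhLaw q)
  have hmean : ∀ q : Fin t, ∫ D, v (D q) ∂(slhLaw n m t) =
      ∫ π, strataMean v (fun kl => π kl.1 kl.2 q) ∂(strataLaw n m t) := by
    intro q
    have h1 := (measurePreserving_eval_slhLaw (n := n) (m := m) q).hasLaw.integral_comp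
      hv2.aestronglyMeasurable
    have h2 := (measurePreserving_sliceDesign (n := n) (m := m) q).hasLaw.integral_comp
      hv2.aestronglyMeasurable
    have h3 := (measurePreserving_sliceDesign (n := n) (m := m) q).integrable_comp_of_integrable hvi
    refine (h1.trans h2.symm).trans ?_
    exact integral_prod _ h3
  have hprod : ∫ D, v (D r) * v (D s) ∂(slhLaw n m t) =
      ∫ π, strataMean v (fun kl => π kl.1 kl.2 r) * strataMean v (fun kl => π kl.1 kl.2 s)
        ∂(strataLaw n m t) := by
    have hint : Integrable (fun D : Fin t → Design n m => v (D r) * v (D s)) (slhLaw n m t) :=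
      (hmem r).integrable_mul (hmem s)
    have h1 := (measurePreserving_sliceDesigns n m t).hasLaw.integral_comp
      hint.aestronglyMeasurable
    have h2 := (measurePreserving_sliceDesigns n m t).integrable_comp_of_integrable hint
    refine h1.symm.trans ((integral_prod _ h2).trans ?_)
    refine integral_congr_ae (ae_of_all _ fun π => ?_)
    have hmeas : ∀ q : Fin t, AEMeasurable (fun z => v (sliceDesign (fun k l => π k l q) z))
        (cellLaw n m) := fun q => (integrable_sliceDesign hvi r _).aemeasurable
    have hind := (iIndepFun_pi (μ := fun _ : Fin t => cellLaw n m) hmeas).indepFun hrs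
    have hm : ∀ q : Fin t, AEStronglyMeasurable
        (fun z : Fin t → LatinHypercube n m × (Fin n → Fin m → ℝ) =>
          v (sliceDesign (fun k l => π k l q) (z q))) (Measure.pi fun _ => cellLaw n m) := fun q =>
      ((hmeas q).comp_quasiMeasurePreserving
        (Measure.quasiMeasurePreserving_eval _ q)).aestronglyMeasurable
    have he : ∀ q : Fin t, ∫ z, v (sliceDesign (fun k l => π k l q) (z q))
        ∂(Measure.pi fun _ : Fin t => cellLaw n m) = strataMean v (fun kl => π kl.1 kl.2 q) :=
      fun q => (measurePreserving_eval (fun _ : Fin t => cellLaw n m) q).hasLaw.integral_comp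
        (hmeas q).aestronglyMeasurable
    have h3 := hind.integral_fun_mul_eq_mul_integral (hm r) (hm s)
    rw [he r, he s] at h3
    exact h3
  have key := card_mul_sum_pi_perm_le hrs (strataMean (n := n) (m := m) v) (strataMean v)
    (hv.similarlyMonotone_strataMean hvi r)
  rw [covariance_eq_sub (hmem r) (hmem s)]
  simp only [Pi.mul_apply]
  rw [hprod, hmean r, hmean s, integral_strataLaw, integral_strataLaw, integral_strataLaw]
  simp only [Function.curry, Prod.mk.eta]
  set N : ℝ := (Fintype.card (Fin m × Fin n → Equiv.Perm (Fin t)) : ℝ)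
  have hN : 0 < N := Nat.cast_pos.2 Fintype.card_pos
  have hN1 : N⁻¹ * N = 1 := inv_mul_cancel₀ hN.ne'
  have key' := mul_le_mul_of_nonneg_left key (sq_nonneg N⁻¹)
  linear_combination key' - N⁻¹ * hN1 *
    ∑ π : Fin m × Fin n → Equiv.Perm (Fin t), strataMean v (fun i => π i r) *
      strataMean v (fun i => π i s)

theorem variance_lowerBound {n m t : ℕ} {v : Design n m → ℝ} {ν : Measure (Fin t → Design n m)}
    [IsFiniteMeasure ν] (h : ∀ r, MemLp (fun D : Fin t → Design n m => v (D r)) 2 ν) :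
    Var[lowerBound v; ν] = ((t : ℝ)⁻¹) ^ 2 *
      ∑ r, ∑ s, cov[fun D : Fin t → Design n m => v (D r), fun D => v (D s); ν] := by
  have h1 : (lowerBound v : (Fin t → Design n m) → ℝ) =
      fun D => (t : ℝ)⁻¹ * ∑ r, v (D r) := by
    funext D
    rw [lowerBound, div_eq_inv_mul]
  rw [h1, variance_const_mul, variance_fun_sum h]

theorem aemeasurable_lowerBound {n m t : ℕ} {v : Design n m → ℝ} (hv : AEMeasurable v (lhLaw n m))
    {ν : Measure (Fin t → Design n m)}
    (hν : ∀ r, MeasurePreserving (fun D : Fin t → Design n m => D r) ν (lhLaw n m)) :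
    AEMeasurable (lowerBound v : (Fin t → Design n m) → ℝ) ν :=
  (Finset.aemeasurable_fun_sum _ fun r _ =>
    hv.comp_quasiMeasurePreserving (hν r).quasiMeasurePreserving).div_const _

/-- If the estimator is square-integrable for independent batches, so is the value of a single
batch: fix the other batches. -/
theorem memLp_of_memLp_lowerBound {n m t : ℕ} (ht : 0 < t) {v : Design n m → ℝ}
    (h : MemLp (lowerBound v) 2 (ilhLaw n m t)) : MemLp v 2 (lhLaw n m) := by
  obtain ⟨t, rfl⟩ : ∃ t', t = t' + 1 := ⟨t - 1, by omega⟩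
  have hmp := (measurePreserving_piFinSuccAbove (fun _ : Fin (t + 1) => lhLaw n m) 0).symm
  have h1 := h.comp_measurePreserving hmp
  have h2 := h1.integrable_sq.prod_left_ae
  have h3 := h1.aestronglyMeasurable.prodMk_right
  obtain ⟨R, hR2, hRm⟩ := (h2.and h3).exists
  have h4 : MemLp (fun d : Design n m => (v d + ∑ j, v (R j)) / ((t + 1 : ℕ) : ℝ)) 2
      (lhLaw n m) := by
    have h5 := (memLp_two_iff_integrable_sq hRm).2 hR2
    convert h5 using 1
    funext d
    simp [lowerBound, Fin.sum_univ_succ, MeasurableEquiv.piFinSuccAbove]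
  have h6 := (h4.const_mul ((t + 1 : ℕ) : ℝ)).sub (memLp_const (∑ j, v (R j)))
  have h7 : v = fun d => ((t + 1 : ℕ) : ℝ) * ((v d + ∑ j, v (R j)) / ((t + 1 : ℕ) : ℝ)) -
      ∑ j, v (R j) := by
    funext d
    rw [mul_div_cancel₀ _ (Nat.cast_ne_zero.2 (Nat.succ_ne_zero t))]
    ring
  rw [h7]
  exact h6

theorem evariance_comp_of_hasLaw {Ω 𝓧 : Type*} [MeasurableSpace Ω] [MeasurableSpace 𝓧]
    {P : Measure Ω} {μ : Measure 𝓧} {X : Ω → 𝓧} (hX : HasLaw X μ P) {f : 𝓧 → ℝ}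
    (hf : AEMeasurable f μ) : evariance (fun ω => f (X ω)) P = evariance f μ := by
  have h1 : ∫ ω, f (X ω) ∂P = ∫ x, f x ∂μ := hX.integral_comp hf.aestronglyMeasurable
  rw [evariance, evariance, h1]
  exact hX.lintegral_comp (f := fun x => ‖f x - ∫ x, f x ∂μ‖ₑ ^ 2) (by fun_prop)

/-- Comparison of the two sampling schemes for any monotonic function of a batch. -/
theorem IsMonotonic.evariance_slhLaw_le {n m t : ℕ} {v : Design n m → ℝ} (hv : IsMonotonic v) :
    evariance (lowerBound v) (slhLaw n m t) ≤ evariance (lowerBound v) (ilhLaw n m t) := by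
  rcases Nat.eq_zero_or_pos t with rfl | ht
  · -- With no batches the estimator is the constant `0 / 0 = 0`.
    have h0 : (lowerBound v : (Fin 0 → Design n m) → ℝ) = 0 := by
      funext D; simp [lowerBound]
    simp [h0]
  have hilh : ∀ r, MeasurePreserving (fun D : Fin t → Design n m => D r) (ilhLaw n m t)
      (lhLaw n m) := fun r => measurePreserving_eval _ r
  have hslh : ∀ r, MeasurePreserving (fun D : Fin t → Design n m => D r) (slhLaw n m t)
      (lhLaw n m) := fun r => measurePreserving_eval_slhLaw r
  by_cases hL : MemLp (lowerBound v) 2 (ilhLaw n m t)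
  swap
  · rw [evariance_eq_top (aemeasurable_lowerBound hv.aemeasurable hilh).aestronglyMeasurable hL]
    exact le_top
  have hv2 : MemLp v 2 (lhLaw n m) := memLp_of_memLp_lowerBound ht hL
  have hmi := fun r => hv2.comp_measurePreserving (hilh r)
  have hms := fun r => hv2.comp_measurePreserving (hslh r)
  have hS : MemLp (lowerBound v) 2 (slhLaw n m t) := by
    have h1 := (memLp_finsetSum Finset.univ fun r _ => hms r).const_mul (t : ℝ)⁻¹
    refine h1.congr_norm (aemeasurable_lowerBound hv.aemeasurable hslh).aestronglyMeasurable
      (ae_of_all _ fun D => ?_)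
    simp [lowerBound, div_eq_inv_mul]
  rw [← ofReal_variance hL, ← ofReal_variance hS]
  refine ENNReal.ofReal_le_ofReal ?_
  rw [variance_lowerBound hmi, variance_lowerBound hms]
  refine mul_le_mul_of_nonneg_left ?_ (sq_nonneg _)
  refine Finset.sum_le_sum fun r _ => Finset.sum_le_sum fun s _ => ?_
  by_cases hrs : r = s
  · subst hrs
    have e1 := (hslh r).hasLaw.covariance_fun_comp hv.aemeasurable hv.aemeasurable
    have e2 := (hilh r).hasLaw.covariance_fun_comp hv.aemeasurable hv.aemeasurable
    exact (e1.trans e2.symm).le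
  · have hind := (iIndepFun_pi (μ := fun _ : Fin t => lhLaw n m) (X := fun _ => v)
      fun _ => hv.aemeasurable).indepFun hrs
    have h0 := hind.covariance_eq_zero (hmi r) (hmi s)
    exact (hv.covariance_slices_nonpos hv2 hrs).trans h0.ge

end SAA

end

theorem mainTheorem1 {p n m t : ℕ}
    (X : Set (EuclideanSpace ℝ (Fin p))) (hX : IsCompact X) (hX_ne : X.Nonempty)
    (G : EuclideanSpace ℝ (Fin p) → (Fin m → ℝ) → ℝ)
    (hG : Measurable (Function.uncurry G))
    (hfin : ∀ D ∈ SAA.designSpace n m, BddBelow (SAA.saaObjective G D '' X))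
    (hmono : SAA.IsMonotonic (SAA.saaValue (n := n) X G))
    {Ω Ω' : Type*} [MeasurableSpace Ω] [MeasurableSpace Ω']
    (P : Measure Ω) (P' : Measure Ω')
    (D_ILH : Ω → Fin t → SAA.Design n m) (h_ILH : HasLaw D_ILH (SAA.ilhLaw n m t) P)
    (D_SLH : Ω' → Fin t → SAA.Design n m) (h_SLH : HasLaw D_SLH (SAA.slhLaw n m t) P') :
    evariance (fun ω => SAA.lowerBound (SAA.saaValue X G) (D_SLH ω)) P' ≤
      evariance (fun ω => SAA.lowerBound (SAA.saaValue X G) (D_ILH ω)) P := by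
  rw [SAA.evariance_comp_of_hasLaw h_SLH (SAA.aemeasurable_lowerBound hmono.aemeasurable
      SAA.measurePreserving_eval_slhLaw),
    SAA.evariance_comp_of_hasLaw h_ILH (SAA.aemeasurable_lowerBound hmono.aemeasurable
      fun r => measurePreserving_eval _ r)]
  exact hmono.evariance_slhLaw_le
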